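/- **Setting.** Let $H$ be a complex Hilbert space, $m\ge 1$, $R_0\in B(H)$ positive and trace class, and $C_1,\dots,C_m\in B(H)$ contractions. For finite words $w$ over $\{1,\dots,m\}$ define $R_\emptyset:=R_0$, $R_{wj}:=R_w^{1/2}(I-C_j^*C_j)R_w^{1/2}$, $D_{w,j}:=R_w^{1/2}C_j^*C_jR_w^{1/2}$ and $s_w:=\sum_{j=1}^m\operatorname{tr}(D_{w,j})$. Let $\Omega=\{0,1,\dots,m\}^{\mathbb N}$ with its product $\sigma$-field and cylinders $[u]$. If a word $u$ over $\{0,\dots,m\}$ contains no $0$ and $s_u>0$, put $p_{u,0}:=0$ and $p_{u,j}:=\operatorname{tr}(D_{u,j})/s_u$ for $1\le j\le m$; if $u$ contains $0$ or $s_u=0$, put $p_{u,0}:=1$ and $p_{u,j}:=0$ for $1\le j\le m$. Let $\nu_{\mathrm{tr}}$ be the unique probability measure on $\Omega$ with $\nu_{\mathrm{tr}}([ua])=\nu_{\mathrm{tr}}([u])\,p_{u,a}$ for all $u$ and $a$. For $\omega\in\Omega$ let $R_n(\omega):=R_v$, where $v$ is the maximal prefix of $\omega_1\cdots\omega_n$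 containing no $0$, and let $R_\infty(\omega)$ be the strong operator limit of $R_n(\omega)$. It exists and lies in the cone $S_1(H)_+$ of positive trace class operators, which carries the Borel $\sigma$-field of the trace norm. The WR boundary $\sigma$-field is $\mathcal B_{\mathrm{WR}}:=\sigma(R_\infty)$; it is called trivial modulo $\nu_{\mathrm{tr}}$ if $\nu_{\mathrm{tr}}(E)\in\{0,1\}$ for every $E\in\mathcal B_{\mathrm{WR}}$. **Corollary (trivial boundary).** (a) $\mathcal B_{\mathrm{WR}}$ is trivial modulo $\nu_{\mathrm{tr}}$ if and only if there is $T\in S_1(H)_+$ such that $R_\infty(\omega)=T$ for $\nu_{\mathrm{tr}}$-almost every $\omega$. (b) In particular, if $\operatorname{tr}(R_n(\omega))\to 0$ for $\nu_{\mathrm{tr}}$-almost every $\omega$ (trace extinction), then $R_\infty=0$ $\nu_{\mathrm{tr}}$-almost surely and $\mathcal B_{\mathrm{WR}}$ is trivial modulo $\nu_{\mathrm{tr}}$. (c) If uniform trace leakage holds, i.e. there is $\alpha\in(0,m]$ with $s_w\ge\alpha\operatorname{tr}(R_w)$ for every finite word $w$ over $\{1,\dots,m\}$, then $\operatorname{tr}(R_n(\omega))\to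 0$ for $\nu_{\mathrm{tr}}$-almost every $\omega$; hence $R_\infty=0$ $\nu_{\mathrm{tr}}$-almost surely and $\mathcal B_{\mathrm{WR}}$ is trivial modulo $\nu_{\mathrm{tr}}$. -/

import Mathlib

open MeasureTheory Filter Topology

namespace WRTree

noncomputable section

/-! ### Trace class operators -/

section TraceClass

variable (H : Type*) [NormedAddCommGroup H] [InnerProductSpace ℂ H] [CompleteSpace H]

/-- The index set of a fixed orthonormal basis of `H`. -/
def basisIndex : Set H := (exists_hilbertBasis ℂ H).choose

/-- A fixed orthonormal basis of the Hilbert space `H`, used to evaluate traces. -/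
def onb : HilbertBasis (basisIndex H) ℂ H := (exists_hilbertBasis ℂ H).choose_spec.choose

variable {H}

/-- The trace `tr A = ∑ᵢ ⟨eᵢ, A eᵢ⟩` (meaningful when `A` is trace class). -/
def opTrace (A : H →L[ℂ] H) : ℂ := ∑' i, inner ℂ (onb H i) (A (onb H i))

/-- The trace norm `‖A‖₁ = tr |A| = ∑ᵢ ⟨eᵢ, |A| eᵢ⟩ ∈ [0, ∞]`, with `|A| = (A* A)^{1/2}`. -/
def traceNorm (A : H →L[ℂ] H) : ENNReal :=
  ∑' i, ENNReal.ofReal (inner ℂ (onb H i) (CFC.abs A (onb H i))).re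

/-- `A` is trace class, i.e. `A ∈ S₁(H)`. -/
def IsTraceClass (A : H →L[ℂ] H) : Prop := traceNorm A < ⊤

variable (H) in
/-- The positive cone `S₁(H)₊` of the trace class. -/
@[ext] structure PosTraceClass where
  /-- the underlying bounded operator -/
  op : H →L[ℂ] H
  nonneg : 0 ≤ op
  traceClass : IsTraceClass op

/-- The trace norm topology on `S₁(H)₊`: a set is open iff around each of its points it contains
a ball for the distance `‖S - T‖₁`. -/
instance : TopologicalSpace (PosTraceClass H) where
  IsOpen U := ∀ T ∈ U, ∃ ε : ℝ, 0 < ε ∧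
    ∀ S : PosTraceClass H, traceNorm (S.op - T.op) < ENNReal.ofReal ε → S ∈ U
  isOpen_univ := fun _ _ => ⟨1, one_pos, fun _ _ => Set.mem_univ _⟩
  isOpen_inter := by
    rintro U V hU hV T ⟨hTU, hTV⟩
    obtain ⟨ε, hε, h⟩ := hU T hTU
    obtain ⟨δ, hδ, h'⟩ := hV T hTV
    refine ⟨min ε δ, lt_min hε hδ, fun S hS => ⟨h S ?_, h' S ?_⟩⟩
    · exact hS.trans_le (ENNReal.ofReal_le_ofReal (min_le_left _ _))
    · exact hS.trans_le (ENNReal.ofReal_le_ofReal (min_le_right _ _))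
  isOpen_sUnion := by
    rintro s hs T ⟨U, hU, hT⟩
    obtain ⟨ε, hε, h⟩ := hs U hU T hT
    exact ⟨ε, hε, fun S hS => ⟨U, hU, h S hS⟩⟩

/-- The Borel `σ`-field of `S₁(H)₊` for the trace norm topology. -/
instance : MeasurableSpace (PosTraceClass H) := borel _

instance : BorelSpace (PosTraceClass H) := ⟨rfl⟩

lemma traceNorm_of_nonneg {A : H →L[ℂ] H} (hA : 0 ≤ A) :
    traceNorm A = ∑' i, ENNReal.ofReal (inner ℂ (onb H i) (A (onb H i))).re := by
  rw [traceNorm, CFC.abs_of_nonneg A hA]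

lemma re_inner_nonneg {A : H →L[ℂ] H} (hA : 0 ≤ A) (x : H) : 0 ≤ (inner ℂ x (A x)).re :=
  ((ContinuousLinearMap.nonneg_iff_isPositive A).1 hA).re_inner_nonneg_right x

lemma re_inner_mono {A B : H →L[ℂ] H} (hAB : A ≤ B) (x : H) :
    (inner ℂ x (A x)).re ≤ (inner ℂ x (B x)).re := by
  have h := re_inner_nonneg (sub_nonneg.2 hAB) x
  simp only [sub_apply, inner_sub_right, Complex.sub_re] at h
  linarith

lemma IsTraceClass.of_le {A B : H →L[ℂ] H} (hA : 0 ≤ A) (hAB : A ≤ B) (hB : IsTraceClass B) :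
    IsTraceClass A := by
  rw [IsTraceClass, traceNorm_of_nonneg (hA.trans hAB)] at hB
  rw [IsTraceClass, traceNorm_of_nonneg hA]
  exact (ENNReal.tsum_le_tsum fun i =>
    ENNReal.ofReal_le_ofReal (re_inner_mono hAB _)).trans_lt hB

lemma re_opTrace_nonneg {A : H →L[ℂ] H} (hA : 0 ≤ A) : 0 ≤ (opTrace A).re := by
  by_cases h : Summable fun i => inner ℂ (onb H i) (A (onb H i))
  · rw [opTrace, Complex.re_tsum h]
    exact tsum_nonneg fun i => re_inner_nonneg hA _
  · rw [opTrace, tsum_eq_zero_of_not_summable h]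
    simp

end TraceClass

/-! ### The contraction energy tree -/

section Tree

variable {H : Type*} [NormedAddCommGroup H] [InnerProductSpace ℂ H] [CompleteSpace H] {m : ℕ}

/-- The residual update `Φ_C(R) = R^{1/2} (I - C* C) R^{1/2}`. -/
def update (C R : H →L[ℂ] H) : H →L[ℂ] H := CFC.sqrt R * (1 - star C * C) * CFC.sqrt R

/-- The residual `R_w` at the word `w` over `{1, …, m}`: `R_∅ = R₀` and `R_{wj} = Φ_j(R_w)`. The
letter `j + 1` is encoded by `j : Fin m`. -/
def residual (R₀ : H →L[ℂ] H) (C : Fin m → H →L[ℂ] H) (w : List (Fin m)) : H →L[ℂ] H :=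
  w.foldl (fun R j => update (C j) R) R₀

/-- The dissipated piece `D_{w,j} = R_w^{1/2} C_j* C_j R_w^{1/2}`. -/
def dissipation (R₀ : H →L[ℂ] H) (C : Fin m → H →L[ℂ] H) (w : List (Fin m)) (j : Fin m) :
    H →L[ℂ] H :=
  CFC.sqrt (residual R₀ C w) * (star (C j) * C j) * CFC.sqrt (residual R₀ C w)

/-- The trace edge-energy `tr D_{w,j}`. -/
def edgeEnergy (R₀ : H →L[ℂ] H) (C : Fin m → H →L[ℂ] H) (w : List (Fin m)) (j : Fin m) : ℝ :=
  (opTrace (dissipation R₀ C w j)).re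

/-- The total trace edge-energy `s_w = ∑ⱼ tr D_{w,j}` of a node. -/
def nodeEnergy (R₀ : H →L[ℂ] H) (C : Fin m → H →L[ℂ] H) (w : List (Fin m)) : ℝ :=
  ∑ j, edgeEnergy R₀ C w j

/-- Uniform trace leakage: for some `α ∈ (0, m]`, `s_w ≥ α tr R_w` at every node `w`. -/
def UniformTraceLeakage (R₀ : H →L[ℂ] H) (C : Fin m → H →L[ℂ] H) : Prop :=
  ∃ α : ℝ, 0 < α ∧ α ≤ m ∧
    ∀ w : List (Fin m), α * (opTrace (residual R₀ C w)).re ≤ nodeEnergy R₀ C w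

/-- The maximal prefix without `0` of a word over `{0, 1, …, m}`. -/
def livePrefix : List (Fin (m + 1)) → List (Fin m)
  | [] => []
  | a :: u => Fin.cases (motive := fun _ => List (Fin m)) [] (fun j => j :: livePrefix u) a

/-- The trace-biased transition probability `p_{u,a}` from a word `u` over `{0, 1, …, m}` to the
letter `a`: words that contain `0` and nodes with `s_u = 0` move to `0` with probability one, all
other words move to `j ≥ 1` with probability `tr D_{u,j} / s_u`. -/
def transition (R₀ : H →L[ℂ] H) (C : Fin m → H →L[ℂ] H) (u : List (Fin (m + 1)))
    (a : Fin (m + 1)) : ℝ :=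
  open Classical in
  if 0 ∈ u ∨ nodeEnergy R₀ C (livePrefix u) = 0 then
    if a = 0 then 1 else 0
  else
    Fin.cases (motive := fun _ => ℝ) 0
      (fun j => edgeEnergy R₀ C (livePrefix u) j / nodeEnergy R₀ C (livePrefix u)) a

/-! ### Path space and path measures -/

/-- The path space `Ω = {0, 1, …, m}^ℕ` with its product `σ`-field; the `n`-th letter of `ω`,
`n ≥ 1`, is `ω (n - 1)`. -/
abbrev PathSpace (m : ℕ) : Type := ℕ → Fin (m + 1)

/-- The prefix `ω|n` of length `n`. -/
def pathPrefix (ω : PathSpace m) (n : ℕ) : List (Fin (m + 1)) := (List.range n).map ω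

/-- The cylinder `[u]` of all paths that begin with the word `u`. -/
def cyl (u : List (Fin (m + 1))) : Set (PathSpace m) := {ω | pathPrefix ω u.length = u}

/-- `ν` is the probability measure on the path space with the cylinder weights `ν[∅] = 1` and
`ν[ua] = ν[u] p_{u,a}`. -/
def IsPathMeasure (p : List (Fin (m + 1)) → Fin (m + 1) → ℝ) (ν : Measure (PathSpace m)) : Prop :=
  ν (cyl []) = 1 ∧ ∀ u a, ν (cyl (u ++ [a])) = ν (cyl u) * ENNReal.ofReal (p u a)

lemma length_pathPrefix (ω : PathSpace m) (n : ℕ) : (pathPrefix ω n).length = n := by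
  simp [pathPrefix]

lemma pathPrefix_succ (ω : PathSpace m) (n : ℕ) :
    pathPrefix ω (n + 1) = pathPrefix ω n ++ [ω n] := by
  simp [pathPrefix, List.range_succ]

lemma cyl_nil : cyl (m := m) [] = Set.univ := by
  ext ω; simp [cyl, pathPrefix]

lemma cyl_append (u : List (Fin (m + 1))) (a : Fin (m + 1)) :
    cyl (u ++ [a]) = cyl u ∩ {ω | ω u.length = a} := by
  ext ω
  have h : (pathPrefix ω u.length).length = u.length := length_pathPrefix _ _
  simp only [cyl, Set.mem_ofPred_eq, List.length_append, List.length_singleton, pathPrefix_succ,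
    Set.mem_inter_iff]
  constructor
  · intro hh
    have := List.append_inj hh h
    simpa using this
  · rintro ⟨h1, h2⟩
    rw [h1, h2]

lemma measurableSet_cyl (u : List (Fin (m + 1))) : MeasurableSet (cyl u) := by
  induction u using List.reverseRecOn with
  | nil => rw [cyl_nil]; exact MeasurableSet.univ
  | append_singleton u a ih =>
    rw [cyl_append]
    exact ih.inter ((measurable_pi_apply (X := fun _ : ℕ => Fin (m + 1)) u.length)
      (measurableSet_singleton a))

lemma isPathMeasure_unique {p : List (Fin (m + 1)) → Fin (m + 1) → ℝ}
    {μ ν : Measure (PathSpace m)} (hμ : IsPathMeasure p μ) (hν : IsPathMeasure p ν) : μ = ν := by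
  have h1 : μ Set.univ = 1 := by rw [← cyl_nil, hμ.1]
  have h2 : ν Set.univ = 1 := by rw [← cyl_nil, hν.1]
  have : IsFiniteMeasure μ := ⟨by rw [h1]; exact ENNReal.one_lt_top⟩
  have hc : ∀ u, μ (cyl u) = ν (cyl u) := by
    intro u
    induction u using List.reverseRecOn with
    | nil => rw [hμ.1, hν.1]
    | append_singleton u a ih => rw [hμ.2, hν.2, ih]
  refine ext_of_generate_finite (Set.range cyl) (le_antisymm ?_ ?_) ?_ ?_ (by rw [h1, h2])
  · refine iSup_le fun n => ?_
    rintro _ ⟨s, -, rfl⟩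
    have : (fun ω : PathSpace m => ω n) ⁻¹' s =
        ⋃ u : {u : List (Fin (m + 1)) // ∃ v a, u = v ++ [a] ∧ v.length = n ∧ a ∈ s},
          cyl u.1 := by
      ext ω
      simp only [Set.mem_preimage, Set.mem_iUnion]
      constructor
      · intro hω
        refine ⟨⟨pathPrefix ω (n + 1), pathPrefix ω n, ω n, pathPrefix_succ _ _,
          length_pathPrefix _ _, hω⟩, ?_⟩
        simp [cyl, length_pathPrefix]
      · rintro ⟨⟨_, v, a, rfl, hv, ha⟩, hω⟩
        rw [cyl_append, hv] at hω
        have : ω n = a := hω.2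
        rwa [this]
    rw [this]
    exact MeasurableSet.iUnion fun u => MeasurableSpace.measurableSet_generateFrom ⟨u.1, rfl⟩
  · refine MeasurableSpace.generateFrom_le ?_
    rintro _ ⟨u, rfl⟩
    exact measurableSet_cyl u
  · have key : ∀ u v : List (Fin (m + 1)), u.length ≤ v.length → (cyl u ∩ cyl v).Nonempty →
        cyl u ∩ cyl v = cyl v := by
      rintro u v huv ⟨ω, hu, hv⟩
      refine Set.inter_eq_right.2 fun η hη => ?_
      have e : ∀ ω : PathSpace m, pathPrefix ω u.length = (pathPrefix ω v.length).take u.length := by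
        intro ω
        simp [pathPrefix, ← List.map_take, List.take_range, min_eq_left huv]
      have hη' : pathPrefix η v.length = v := hη
      have hv' : pathPrefix ω v.length = v := hv
      have hu' : pathPrefix ω u.length = u := hu
      change pathPrefix η u.length = u
      rw [e, hη', ← hv', ← e, hu']
    rintro _ ⟨u, rfl⟩ _ ⟨v, rfl⟩ hne
    rcases le_total u.length v.length with h | h
    · exact ⟨v, (key u v h hne).symm⟩
    · rw [Set.inter_comm] at hne ⊢
      exact ⟨u, (key v u h hne).symm⟩
  · rintro _ ⟨u, rfl⟩
    exact hc u

/-- Kolmogorov extension: a consistent family of cylinder weights is carried by exactly one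
measure. -/
theorem existsUnique_isPathMeasure (p : List (Fin (m + 1)) → Fin (m + 1) → ℝ)
    (hp0 : ∀ u a, 0 ≤ p u a) (hp1 : ∀ u, ∑ a, p u a = 1) :
    ∃! ν : Measure (PathSpace m), IsPathMeasure p ν := by
  refine existsUnique_of_exists_of_unique ?_ fun _ _ h h' => isPathMeasure_unique h h'
  let X : ℕ → Type := fun _ => Fin (m + 1)
  let word : (n : ℕ) → ((i : Finset.Iic n) → X i) → List (Fin (m + 1)) := fun n x =>
    (List.range n).map fun k => if h : k + 1 ∈ Finset.Iic n then x ⟨k + 1, h⟩ else 0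
  let κ : (n : ℕ) → ProbabilityTheory.Kernel ((i : Finset.Iic n) → X i) (X (n + 1)) := fun n =>
    { toFun := fun x => ∑ a : Fin (m + 1), ENNReal.ofReal (p (word n x) a) • Measure.dirac a
      measurable' := measurable_of_countable _ }
  have hκ : ∀ n (x : (i : Finset.Iic n) → X i) (a : Fin (m + 1)),
      κ n x {a} = ENNReal.ofReal (p (word n x) a) := by
    intro n x a
    change (∑ b : Fin (m + 1), ENNReal.ofReal (p (word n x) b) • Measure.dirac b) {a} = _
    rw [Measure.finsetSum_apply, Finset.sum_eq_single a]
    · simp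
    · intro b _ hb
      simp [Set.indicator, hb]
    · simp
  have : ∀ n, ProbabilityTheory.IsMarkovKernel (κ n) := by
    refine fun n => ⟨fun x => ⟨?_⟩⟩
    change (∑ b : Fin (m + 1), ENNReal.ofReal (p (word n x) b) • Measure.dirac b) Set.univ = _
    rw [Measure.finsetSum_apply]
    simp only [Measure.smul_apply, measure_univ, smul_eq_mul, mul_one]
    rw [← ENNReal.ofReal_sum_of_nonneg fun a _ => hp0 _ a, hp1, ENNReal.ofReal_one]
  let μ₀ : Measure (X 0) := Measure.dirac (0 : Fin (m + 1))
  let P : Measure ((n : ℕ) → X n) := ProbabilityTheory.Kernel.trajMeasure μ₀ κ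
  have hP : IsProbabilityMeasure P := inferInstance
  let shift : ((n : ℕ) → X n) → PathSpace m := fun y n => y (n + 1)
  have hs : Measurable shift := measurable_pi_lambda _ fun n => measurable_pi_apply (n + 1)
  refine ⟨P.map shift, ?_, ?_⟩
  · rw [cyl_nil, Measure.map_apply hs MeasurableSet.univ, Set.preimage_univ, measure_univ]
  · intro u a
    rw [Measure.map_apply hs (measurableSet_cyl _), Measure.map_apply hs (measurableSet_cyl _)]
    set n := u.length with hn
    have hw : ∀ y : (n : ℕ) → X n,
        word n (Preorder.frestrictLe n y) = pathPrefix (shift y) n := by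
      intro y
      refine List.map_congr_left fun k hk => ?_
      have : k + 1 ∈ Finset.Iic n := by
        have := List.mem_range.1 hk
        simp only [Finset.mem_Iic]; omega
      simp only [this, dif_pos]
      rfl
    let S : Set ((i : Finset.Iic n) → X i) := {x | word n x = u}
    have hS : MeasurableSet S := S.to_countable.measurableSet
    have e1 : shift ⁻¹' cyl u = Preorder.frestrictLe n ⁻¹' S := by
      ext y
      change pathPrefix (shift y) u.length = u ↔ word n (Preorder.frestrictLe n y) = u
      rw [hw]
    have e2 : shift ⁻¹' cyl (u ++ [a]) =
        (fun y : (n : ℕ) → X n => (Preorder.frestrictLe n y, y (n + 1))) ⁻¹' (S ×ˢ {a}) := by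
      rw [cyl_append, Set.preimage_inter, e1]
      rfl
    have ha : MeasurableSet ({a} : Set (X (n + 1))) := measurableSet_singleton a
    have hr : Measurable (Preorder.frestrictLe (π := X) n) := by fun_prop
    rw [e2, e1, ← Measure.map_apply (by fun_prop) (hS.prod ha), ← Measure.map_apply hr hS,
      ← ProbabilityTheory.Kernel.map_frestrictLe_trajMeasure_compProd_eq_map_trajMeasure,
      Measure.compProd_apply_prod hS ha]
    rw [setLIntegral_congr_fun (g := fun _ => ENNReal.ofReal (p u a)) hS, setLIntegral_const,
      mul_comm]
    intro x hx
    change κ n x {a} = _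
    rw [hκ, show word n x = u from hx]

/-! ### The trace-biased path measure -/

lemma dissipation_nonneg (R₀ : H →L[ℂ] H) (C : Fin m → H →L[ℂ] H) (w : List (Fin m))
    (j : Fin m) : 0 ≤ dissipation R₀ C w j :=
  conjugate_nonneg_of_nonneg (star_mul_self_nonneg _) (CFC.sqrt_nonneg _)

lemma edgeEnergy_nonneg (R₀ : H →L[ℂ] H) (C : Fin m → H →L[ℂ] H) (w : List (Fin m))
    (j : Fin m) : 0 ≤ edgeEnergy R₀ C w j :=
  re_opTrace_nonneg (dissipation_nonneg R₀ C w j)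

lemma transition_nonneg (R₀ : H →L[ℂ] H) (C : Fin m → H →L[ℂ] H) (u : List (Fin (m + 1)))
    (a : Fin (m + 1)) : 0 ≤ transition R₀ C u a := by
  unfold transition
  split_ifs
  · exact zero_le_one
  · exact le_rfl
  · refine Fin.cases le_rfl (fun j => ?_) a
    exact div_nonneg (edgeEnergy_nonneg _ _ _ _)
      (Finset.sum_nonneg fun i _ => edgeEnergy_nonneg _ _ _ _)

lemma sum_transition (R₀ : H →L[ℂ] H) (C : Fin m → H →L[ℂ] H) (u : List (Fin (m + 1))) :
    ∑ a, transition R₀ C u a = 1 := by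
  unfold transition
  split_ifs with h
  · simp
  · push Not at h
    rw [Fin.sum_univ_succ]
    simp only [Fin.cases_zero, Fin.cases_succ, zero_add]
    rw [← Finset.sum_div]
    exact div_self h.2

/-- The trace-biased path measure `ν_tr`. -/
def traceMeasure (R₀ : H →L[ℂ] H) (C : Fin m → H →L[ℂ] H) : Measure (PathSpace m) :=
  (existsUnique_isPathMeasure (transition R₀ C) (transition_nonneg R₀ C)
    (sum_transition R₀ C)).choose

lemma isPathMeasure_traceMeasure (R₀ : H →L[ℂ] H) (C : Fin m → H →L[ℂ] H) :
    IsPathMeasure (transition R₀ C) (traceMeasure R₀ C) :=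
  (existsUnique_isPathMeasure (transition R₀ C) (transition_nonneg R₀ C)
    (sum_transition R₀ C)).choose_spec.1

instance (R₀ : H →L[ℂ] H) (C : Fin m → H →L[ℂ] H) : IsProbabilityMeasure (traceMeasure R₀ C) :=
  ⟨by rw [← cyl_nil, (isPathMeasure_traceMeasure R₀ C).1]⟩

/-! ### Residuals along a path and the boundary variable -/

/-- The residual process `R_n(ω) = R_{ω|n}`, frozen at the first occurrence of `0`. -/
def pathResidual (R₀ : H →L[ℂ] H) (C : Fin m → H →L[ℂ] H) (n : ℕ) (ω : PathSpace m) :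
    H →L[ℂ] H :=
  residual R₀ C (livePrefix (pathPrefix ω n))

lemma update_nonneg {C R : H →L[ℂ] H} (hC : ‖C‖ ≤ 1) : 0 ≤ update C R := by
  refine conjugate_nonneg_of_nonneg (sub_nonneg.2 ?_) (CFC.sqrt_nonneg _)
  refine (CStarAlgebra.norm_le_one_iff_of_nonneg _ (star_mul_self_nonneg C)).1 ?_
  rw [CStarRing.norm_star_mul_self]
  exact mul_le_one₀ hC (norm_nonneg _) hC

lemma update_le {C R : H →L[ℂ] H} (hR : 0 ≤ R) : update C R ≤ R := by
  have h := conjugate_le_conjugate_of_nonneg (sub_le_self 1 (star_mul_self_nonneg C))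
    (CFC.sqrt_nonneg R)
  rwa [mul_one, CFC.sqrt_mul_sqrt_self R] at h

lemma residual_append (R₀ : H →L[ℂ] H) (C : Fin m → H →L[ℂ] H) (w : List (Fin m)) (j : Fin m) :
    residual R₀ C (w ++ [j]) = update (C j) (residual R₀ C w) := by
  simp [residual]

lemma residual_nonneg {R₀ : H →L[ℂ] H} (hR₀ : 0 ≤ R₀) {C : Fin m → H →L[ℂ] H}
    (hC : ∀ j, ‖C j‖ ≤ 1) (w : List (Fin m)) : 0 ≤ residual R₀ C w := by
  induction w using List.reverseRecOn with
  | nil => exact hR₀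
  | append_singleton w j _ => rw [residual_append]; exact update_nonneg (hC j)

lemma livePrefix_append (u : List (Fin (m + 1))) (a : Fin (m + 1)) :
    livePrefix (u ++ [a]) = livePrefix u ∨
      ∃ j, livePrefix (u ++ [a]) = livePrefix u ++ [j] := by
  induction u with
  | nil =>
    refine Fin.cases (Or.inl ?_) (fun j => Or.inr ⟨j, ?_⟩) a <;> simp [livePrefix]
  | cons b u ih =>
    refine Fin.cases (Or.inl ?_) (fun i => ?_) b
    · simp [livePrefix]
    · rcases ih with h | ⟨j, h⟩
      · exact Or.inl (by simp [livePrefix, h])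
      · exact Or.inr ⟨j, by simp [livePrefix, h]⟩

lemma pathResidual_antitone {R₀ : H →L[ℂ] H} (hR₀ : 0 ≤ R₀) {C : Fin m → H →L[ℂ] H}
    (hC : ∀ j, ‖C j‖ ≤ 1) (ω : PathSpace m) : Antitone fun n => pathResidual R₀ C n ω := by
  refine antitone_nat_of_succ_le fun n => ?_
  rw [pathResidual, pathResidual, pathPrefix_succ]
  rcases livePrefix_append (pathPrefix ω n) (ω n) with h | ⟨j, h⟩
  · rw [h]
  · rw [h, residual_append]
    exact update_le (residual_nonneg hR₀ hC _)

lemma sq_norm_apply_le {P B : H →L[ℂ] H} (hP : 0 ≤ P) (hPB : P ≤ B) (x : H) :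
    ‖P x‖ ^ 2 ≤ ‖B‖ * (inner ℂ x (P x)).re := by
  have hS := CFC.sqrt_nonneg P
  have hSP : CFC.sqrt P * CFC.sqrt P = P := CFC.sqrt_mul_sqrt_self P
  set S := CFC.sqrt P
  have hsa : star S = S := (IsSelfAdjoint.of_nonneg hS).star_eq
  have h1 : P x = S (S x) := by rw [← hSP]; rfl
  have h2 : (inner ℂ x (P x)).re = ‖S x‖ ^ 2 := by
    have : inner ℂ x (S (S x)) = inner ℂ (S x) (S x) := by
      have := ContinuousLinearMap.adjoint_inner_left S (S x) x
      rw [← ContinuousLinearMap.star_eq_adjoint, hsa] at this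
      exact this.symm
    rw [h1, this, inner_self_eq_norm_sq_to_K]
    norm_cast
  have h3 : ‖S‖ ^ 2 = ‖P‖ := by
    rw [← hSP, ← CStarRing.norm_star_mul_self (x := S) |>.trans (sq ‖S‖).symm, hsa]
  rw [h2]
  calc ‖P x‖ ^ 2 ≤ (‖S‖ * ‖S x‖) ^ 2 := by
        rw [h1]; gcongr; exact S.le_opNorm _
    _ = ‖P‖ * ‖S x‖ ^ 2 := by rw [mul_pow, h3]
    _ ≤ ‖B‖ * ‖S x‖ ^ 2 := by
        gcongr
        exact CStarAlgebra.norm_le_norm_of_nonneg_of_le hP hPB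

/-- A decreasing sequence of positive operators has a strong operator limit, which is positive
and below the first term. -/
theorem exists_strong_limit {R : ℕ → H →L[ℂ] H} (hR : Antitone R) (h0 : ∀ n, 0 ≤ R n) :
    ∃ T : H →L[ℂ] H, (∀ x, Tendsto (fun n => R n x) atTop (𝓝 (T x))) ∧ 0 ≤ T ∧ T ≤ R 0 := by
  have hlim : ∀ x, ∃ y, Tendsto (fun n => R n x) atTop (𝓝 y) := by
    intro x
    set q : ℕ → ℝ := fun n => (inner ℂ x (R n x)).re with hq
    have hqa : Antitone q := fun i j hij => re_inner_mono (hR hij) x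
    have hqc : CauchySeq q := (tendsto_atTop_ciInf hqa
      ⟨0, by rintro _ ⟨n, rfl⟩; exact re_inner_nonneg (h0 n) x⟩).cauchySeq
    refine cauchySeq_tendsto_of_complete (Metric.cauchySeq_iff'.2 fun ε hε => ?_)
    obtain ⟨N, hN⟩ := Metric.cauchySeq_iff'.1 hqc (ε ^ 2 / (‖R 0‖ + 1)) (by positivity)
    refine ⟨N, fun n hn => ?_⟩
    have hP : 0 ≤ R N - R n := sub_nonneg.2 (hR hn)
    have hB : R N - R n ≤ R 0 := (sub_le_self _ (h0 n)).trans (hR (Nat.zero_le N))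
    have h1 := sq_norm_apply_le hP hB x
    have h2 : (inner ℂ x ((R N - R n) x)).re = q N - q n := by
      simp [hq, sub_apply]
    have h3 : q N - q n < ε ^ 2 / (‖R 0‖ + 1) := by
      have := hN n hn
      rw [dist_comm, Real.dist_eq] at this
      exact (le_abs_self _).trans_lt this
    have h5 : 0 ≤ q N - q n := sub_nonneg.2 (hqa hn)
    have h4 : ‖(R N - R n) x‖ ^ 2 < ε ^ 2 := by
      rw [lt_div_iff₀ (by positivity)] at h3
      rw [h2] at h1
      nlinarith
    have h6 := lt_of_pow_lt_pow_left₀ 2 hε.le h4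
    rwa [dist_comm, dist_eq_norm]
  choose f hf using hlim
  let T : H →L[ℂ] H := continuousLinearMapOfTendsto R (tendsto_pi_nhds.2 hf)
  have hT : ∀ x, Tendsto (fun n => R n x) atTop (𝓝 (T x)) := hf
  have hpos : ∀ (A : ℕ → H →L[ℂ] H) (B : H →L[ℂ] H), (∀ n, 0 ≤ A n) →
      (∀ x, Tendsto (fun n => A n x) atTop (𝓝 (B x))) → 0 ≤ B := by
    intro A B hA hAB
    refine (ContinuousLinearMap.nonneg_iff_isPositive B).2
      ((ContinuousLinearMap.isPositive_iff_complex B).2 fun x => ?_)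
    have hl : Tendsto (fun n => inner ℂ (A n x) x) atTop (𝓝 (inner ℂ (B x) x)) :=
      (hAB x).inner tendsto_const_nhds
    have hre := (Complex.continuous_re.tendsto _).comp hl
    have hA' := fun n => (ContinuousLinearMap.isPositive_iff_complex (A n)).1
      ((ContinuousLinearMap.nonneg_iff_isPositive (A n)).1 (hA n)) x
    refine ⟨tendsto_nhds_unique ((Complex.continuous_ofReal.tendsto _).comp hre)
      (hl.congr fun n => (hA' n).1.symm), ge_of_tendsto' hre fun n => (hA' n).2⟩
  refine ⟨T, hT, hpos R T h0 hT, sub_nonneg.1 (hpos (fun n => R 0 - R n) (R 0 - T)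
    (fun n => sub_nonneg.2 (hR (Nat.zero_le n))) fun x => ?_)⟩
  exact tendsto_const_nhds.sub (hT x)

lemma exists_pathResidual_limit (R₀ : PosTraceClass H) {C : Fin m → H →L[ℂ] H}
    (hC : ∀ j, ‖C j‖ ≤ 1) (ω : PathSpace m) :
    ∃ T : PosTraceClass H,
      ∀ x, Tendsto (fun n => pathResidual R₀.op C n ω x) atTop (𝓝 (T.op x)) := by
  obtain ⟨T, hT, h0, hle⟩ := exists_strong_limit (pathResidual_antitone R₀.nonneg hC ω)
    fun n => residual_nonneg R₀.nonneg hC _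
  exact ⟨⟨T, h0, IsTraceClass.of_le h0 hle R₀.traceClass⟩, hT⟩

/-- The boundary variable `R_∞ : Ω → S₁(H)₊`, `R_∞(ω) = s-lim R_n(ω)`. -/
def limitResidual (R₀ : PosTraceClass H) (C : Fin m → H →L[ℂ] H) (hC : ∀ j, ‖C j‖ ≤ 1)
    (ω : PathSpace m) : PosTraceClass H :=
  (exists_pathResidual_limit R₀ hC ω).choose

lemma tendsto_limitResidual (R₀ : PosTraceClass H) (C : Fin m → H →L[ℂ] H)
    (hC : ∀ j, ‖C j‖ ≤ 1) (ω : PathSpace m) (x : H) :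
    Tendsto (fun n => pathResidual R₀.op C n ω x) atTop
      (𝓝 ((limitResidual R₀ C hC ω).op x)) :=
  (exists_pathResidual_limit R₀ hC ω).choose_spec x

/-- The WR boundary `σ`-field `σ(R_∞)` on the path space. -/
abbrev boundarySigma (R₀ : PosTraceClass H) (C : Fin m → H →L[ℂ] H) (hC : ∀ j, ‖C j‖ ≤ 1) :
    MeasurableSpace (PathSpace m) :=
  MeasurableSpace.comap (limitResidual R₀ C hC) inferInstance

/-- The `σ`-field `𝓑` is trivial modulo `ν`-null sets (`ν` a probability measure). -/
def IsTrivialMod (ν : Measure (PathSpace m)) (𝓑 : MeasurableSpace (PathSpace m)) : Prop :=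
  ∀ E, MeasurableSet[𝓑] E → ν E = 0 ∨ ν E = 1

end Tree

end

end WRTree

open WRTree

/-! A random variable whose σ-field is trivial is almost surely constant as soon as countably many
measurable functions determine its values. The basis of `H` may be uncountable, but 0 ≤ R_∞ ≤ R₀,
and R₀, being positive and trace class, kills all but countably many basis vectors
(`countable_onb_ne_zero`). Hence R_∞ is determined by the countably many matrix entries indexed by
the other vectors. Entries are continuous for the trace norm (`continuous_inner_apply`), because
that norm dominates the operator norm, so the events they define lie in the boundary σ-field.

Trace extinction forces R_∞ = 0: every diagonal entry of R_∞ is at most tr R_n, and a positive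
operator annihilates each vector on which its quadratic form vanishes.

For leakage, write t = tr R_w and e_j = tr D_{w,j}, so s = ∑ e_j. Passing to child j lowers the
trace by e_j, and child j has weight e_j / s. The mean trace after one step is therefore t - ∑ e_j²
/ s ≤ t - s / m ≤ (1 - α/m) t, by Cauchy–Schwarz and leakage (`sum_transition_mul_re_opTrace_le`).
The expected traces decay geometrically, so ∑ tr R_n has finite expectation, converges almost
surely, and its terms tend to 0. The cemetery does no harm: it is entered only where s = 0, and
there leakage gives t = 0. -/

namespace WRTree

/-! ### Trace norm estimates and traces of positive operators. -/

section Trace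

variable {H : Type*} [NormedAddCommGroup H] [InnerProductSpace ℂ H] [CompleteSpace H]

lemma re_inner_eq_norm_sq_sqrt {P : H →L[ℂ] H} (hP : 0 ≤ P) (x : H) :
    (inner ℂ x (P x)).re = ‖CFC.sqrt P x‖ ^ 2 := by
  have hS := CFC.sqrt_nonneg P
  have hSP : CFC.sqrt P * CFC.sqrt P = P := CFC.sqrt_mul_sqrt_self P
  set S := CFC.sqrt P
  have hsa : star S = S := (IsSelfAdjoint.of_nonneg hS).star_eq
  have h1 : P x = S (S x) := by rw [← hSP]; rfl
  have h2 : inner ℂ x (S (S x)) = inner ℂ (S x) (S x) := by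
    have := ContinuousLinearMap.adjoint_inner_left S (S x) x
    rw [← ContinuousLinearMap.star_eq_adjoint, hsa] at this
    exact this.symm
  rw [h1, h2, inner_self_eq_norm_sq_to_K]
  norm_cast

lemma hasSum_norm_sq_inner_onb (x : H) :
    HasSum (fun i => ‖inner ℂ (onb H i) x‖ ^ 2) (‖x‖ ^ 2) := by
  have h := Complex.hasSum_re ((onb H).hasSum_inner_mul_inner x x)
  convert h using 1
  · funext i
    rw [← inner_conj_symm x, mul_comm, Complex.mul_conj, Complex.ofReal_re,
      Complex.normSq_eq_norm_sq]
  · rw [inner_self_eq_norm_sq_to_K]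
    norm_cast

/-- Hilbert–Schmidt bound for S = √P: by Parseval, ‖S y‖² = ∑ |⟨S eᵢ, y⟩|² ≤ ∑ ‖S eᵢ‖² ‖y‖², and ∑
‖S eᵢ‖² is the trace of P. Then ‖P‖ = ‖S‖². -/
lemma norm_le_of_nonneg {P : H →L[ℂ] H} (hP : 0 ≤ P) {t : ℝ}
    (ht : traceNorm P ≤ ENNReal.ofReal t) (ht0 : 0 ≤ t) : ‖P‖ ≤ t := by
  have hSP : CFC.sqrt P * CFC.sqrt P = P := CFC.sqrt_mul_sqrt_self P
  have hsa : star (CFC.sqrt P) = CFC.sqrt P :=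
    (IsSelfAdjoint.of_nonneg (CFC.sqrt_nonneg P)).star_eq
  have hbound : ∀ y : H, ‖CFC.sqrt P y‖ ≤ √t * ‖y‖ := by
    intro y
    have h1 : ∀ i, ‖inner ℂ (onb H i) (CFC.sqrt P y)‖ ^ 2 ≤
        (inner ℂ (onb H i) (P (onb H i))).re * ‖y‖ ^ 2 := by
      intro i
      rw [re_inner_eq_norm_sq_sqrt hP, ← mul_pow]
      have := ContinuousLinearMap.adjoint_inner_left (CFC.sqrt P) y (onb H i)
      rw [← ContinuousLinearMap.star_eq_adjoint, hsa] at this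
      rw [← this]
      gcongr
      exact norm_inner_le_norm _ _
    have h2 : ENNReal.ofReal (‖CFC.sqrt P y‖ ^ 2) ≤ ENNReal.ofReal (t * ‖y‖ ^ 2) := by
      rw [← (hasSum_norm_sq_inner_onb (CFC.sqrt P y)).tsum_eq,
        ENNReal.ofReal_tsum_of_nonneg (fun _ => by positivity)
          (hasSum_norm_sq_inner_onb (CFC.sqrt P y)).summable, ENNReal.ofReal_mul ht0]
      refine le_trans ?_ (mul_le_mul_left ht _)
      rw [traceNorm_of_nonneg hP, ← ENNReal.tsum_mul_right]
      refine ENNReal.tsum_le_tsum fun i => ?_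
      rw [← ENNReal.ofReal_mul (re_inner_nonneg hP _)]
      exact ENNReal.ofReal_le_ofReal (h1 i)
    have h3 := (ENNReal.ofReal_le_ofReal_iff (by positivity)).1 h2
    refine le_of_sq_le_sq ?_ (by positivity)
    rwa [mul_pow, Real.sq_sqrt ht0]
  have h4 := (CFC.sqrt P).opNorm_le_bound (Real.sqrt_nonneg t) hbound
  calc ‖P‖ = ‖CFC.sqrt P‖ ^ 2 := by
        rw [sq, ← CStarRing.norm_star_mul_self, hsa, hSP]
    _ ≤ √t ^ 2 := by gcongr
    _ = t := Real.sq_sqrt ht0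

/-- The trace norm dominates the operator norm. -/
lemma norm_le_of_traceNorm_le {A : H →L[ℂ] H} {t : ℝ} (ht : traceNorm A ≤ ENNReal.ofReal t)
    (ht0 : 0 ≤ t) : ‖A‖ ≤ t := by
  have h0 : 0 ≤ CFC.abs A := CFC.abs_nonneg A
  have h1 : ‖CFC.abs A‖ ≤ t := by
    refine norm_le_of_nonneg h0 ?_ ht0
    rwa [traceNorm_of_nonneg h0]
  refine le_trans (le_of_eq ?_) h1
  -- The C*-identity on both sides, since |A|² = A* A.
  have h2 : ‖A‖ * ‖A‖ = ‖CFC.abs A‖ * ‖CFC.abs A‖ := by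
    rw [← CStarRing.norm_star_mul_self, ← CStarRing.norm_star_mul_self (x := CFC.abs A),
      (IsSelfAdjoint.of_nonneg h0).star_eq, CFC.abs_mul_abs]
  exact (mul_self_inj (norm_nonneg _) (norm_nonneg _)).1 h2

/-- The matrix entries are continuous for the trace norm. -/
lemma continuous_inner_apply (x y : H) :
    Continuous fun T : PosTraceClass H => inner ℂ x (T.op y) := by
  refine ⟨fun U hU T hT => ?_⟩
  obtain ⟨δ, hδ, hball⟩ := Metric.isOpen_iff.1 hU _ hT
  -- The `+ 1` keeps the radius positive when `x` or `y` is zero.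
  refine ⟨δ / (‖x‖ * ‖y‖ + 1), by positivity, fun S hS => hball ?_⟩
  have h1 := norm_le_of_traceNorm_le hS.le (by positivity)
  rw [Metric.mem_ball, dist_eq_norm, ← inner_sub_right, ← sub_apply]
  calc ‖inner ℂ x ((S.op - T.op) y)‖ ≤ ‖x‖ * ‖(S.op - T.op) y‖ := norm_inner_le_norm _ _
    _ ≤ ‖x‖ * (‖S.op - T.op‖ * ‖y‖) := by gcongr; exact ContinuousLinearMap.le_opNorm _ _
    _ ≤ ‖x‖ * (δ / (‖x‖ * ‖y‖ + 1) * ‖y‖) := by gcongr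
    _ = δ * (‖x‖ * ‖y‖ / (‖x‖ * ‖y‖ + 1)) := by ring
    _ < δ * 1 := by
        gcongr
        rw [div_lt_one (by positivity)]
        linarith
    _ = δ := mul_one _

/-- Cauchy–Schwarz for the form of P: ‖P x‖² ≤ ‖P‖ ⟨x, P x⟩. -/
lemma apply_eq_zero_of_re_inner_le_zero {P : H →L[ℂ] H} (hP : 0 ≤ P) {x : H}
    (hx : (inner ℂ x (P x)).re ≤ 0) : P x = 0 := by
  have h := sq_norm_apply_le hP le_rfl x
  have h1 : ‖P x‖ ^ 2 ≤ 0 := h.trans (mul_nonpos_of_nonneg_of_nonpos (norm_nonneg _) hx)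
  simpa using h1

lemma eq_of_inner_onb_eq {A B : H →L[ℂ] H}
    (h : ∀ i j, inner ℂ (onb H i) (A (onb H j)) = inner ℂ (onb H i) (B (onb H j))) : A = B := by
  refine ContinuousLinearMap.ext_on (s := Set.range (onb H)) ?_ ?_
  · have := (onb H).dense_span
    rw [Submodule.dense_iff_topologicalClosure_eq_top, this]
  · rintro _ ⟨j, rfl⟩
    refine (onb H).repr.injective (lp.ext (funext fun i => ?_))
    rw [(onb H).repr_apply_apply, (onb H).repr_apply_apply, h]

lemma summable_re_inner {A : H →L[ℂ] H} (hA : 0 ≤ A) (hT : IsTraceClass A) :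
    Summable fun i => (inner ℂ (onb H i) (A (onb H i))).re := by
  rw [IsTraceClass, traceNorm_of_nonneg hA] at hT
  have := ENNReal.summable_toReal hT.ne
  simpa [ENNReal.toReal_ofReal (re_inner_nonneg hA _)] using this

/-- The diagonal entries are real. Summability is not needed: if it fails, both sums take the
default value 0. -/
lemma re_opTrace_eq_tsum {A : H →L[ℂ] H} (hA : 0 ≤ A) :
    (opTrace A).re = ∑' i, (inner ℂ (onb H i) (A (onb H i))).re := by
  have h : ∀ i, inner ℂ (onb H i) (A (onb H i)) =
      (((inner ℂ (onb H i) (A (onb H i))).re : ℝ) : ℂ) := by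
    intro i
    have hp := ((ContinuousLinearMap.nonneg_iff_isPositive A).1 hA).inner_nonneg_right (onb H i)
    exact Complex.ext rfl (by simpa using (Complex.nonneg_iff.1 hp).2.symm)
  rw [opTrace, tsum_congr h, ← Complex.ofReal_tsum, Complex.ofReal_re]

lemma re_inner_onb_le_re_opTrace {A : H →L[ℂ] H} (hA : 0 ≤ A) (hT : IsTraceClass A)
    (i : basisIndex H) : (inner ℂ (onb H i) (A (onb H i))).re ≤ (opTrace A).re := by
  rw [re_opTrace_eq_tsum hA]
  exact (summable_re_inner hA hT).le_tsum i fun j _ => re_inner_nonneg hA _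

lemma re_opTrace_add {A B : H →L[ℂ] H} (hA : 0 ≤ A) (hB : 0 ≤ B) (hTA : IsTraceClass A)
    (hTB : IsTraceClass B) : (opTrace (A + B)).re = (opTrace A).re + (opTrace B).re := by
  rw [re_opTrace_eq_tsum hA, re_opTrace_eq_tsum hB, re_opTrace_eq_tsum (add_nonneg hA hB),
    ← (summable_re_inner hA hTA).tsum_add (summable_re_inner hB hTB)]
  simp

/-- Only countably many vectors of the orthonormal basis are not annihilated by a positive trace
class operator. -/
lemma countable_onb_ne_zero {A : H →L[ℂ] H} (hA : 0 ≤ A) (hT : IsTraceClass A) :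
    {i | A (onb H i) ≠ 0}.Countable := by
  refine (summable_re_inner hA hT).countable_support.mono fun i hi => ?_
  exact fun h0 => hi (apply_eq_zero_of_re_inner_le_zero hA h0.le)

end Trace

/-! ### Trivial boundary σ-field and trace extinction. -/

section Boundary

variable {H : Type*} [NormedAddCommGroup H] [InnerProductSpace ℂ H] [CompleteSpace H] {m : ℕ}
  (R₀ : PosTraceClass H) (C : Fin m → H →L[ℂ] H) (hC : ∀ j, ‖C j‖ ≤ 1)

lemma limitResidual_re_inner_le (ω : PathSpace m) (n : ℕ) (x : H) :
    (inner ℂ x ((limitResidual R₀ C hC ω).op x)).re ≤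
      (inner ℂ x (pathResidual R₀.op C n ω x)).re := by
  have h := (Complex.continuous_re.tendsto _).comp
    ((tendsto_const_nhds (x := x)).inner (𝕜 := ℂ) (tendsto_limitResidual R₀ C hC ω x))
  refine le_of_tendsto h ((eventually_ge_atTop n).mono fun k hk => ?_)
  exact re_inner_mono (pathResidual_antitone R₀.nonneg hC ω hk) x

/-- R_∞ lies below the residual at n = 0, which is R₀. With the next lemma, this confines the
nonzero matrix entries to the countable set of basis vectors not killed by R₀. -/
lemma limitResidual_apply_eq_zero (ω : PathSpace m) {x : H} (hx : R₀.op x = 0) :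
    (limitResidual R₀ C hC ω).op x = 0 := by
  refine apply_eq_zero_of_re_inner_le_zero (limitResidual R₀ C hC ω).nonneg ?_
  refine (limitResidual_re_inner_le R₀ C hC ω 0 x).trans (le_of_eq ?_)
  change (inner ℂ x (R₀.op x)).re = 0
  simp [hx]

lemma inner_limitResidual_eq_zero (ω : PathSpace m) {x : H} (hx : R₀.op x = 0) (y : H) :
    inner ℂ x ((limitResidual R₀ C hC ω).op y) = 0 := by
  have hsa := (IsSelfAdjoint.of_nonneg (limitResidual R₀ C hC ω).nonneg).star_eq
  have := ContinuousLinearMap.adjoint_inner_left (limitResidual R₀ C hC ω).op y x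
  rw [← ContinuousLinearMap.star_eq_adjoint, hsa,
    limitResidual_apply_eq_zero R₀ C hC ω hx, inner_zero_left] at this
  exact this.symm

/-- Words are countable and carry the discrete σ-field, so every function of a prefix is measurable
once the prefix is. -/
instance : MeasurableSpace (List (Fin (m + 1))) := ⊤

instance : DiscreteMeasurableSpace (List (Fin (m + 1))) := ⟨fun _ => trivial⟩

lemma pathPrefix_preimage_singleton (n : ℕ) (u : List (Fin (m + 1))) :
    (fun ω : PathSpace m => pathPrefix ω n) ⁻¹' {u} = if u.length = n then cyl u else ∅ := by
  split_ifs with h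
  · subst h; rfl
  · refine Set.eq_empty_of_forall_notMem fun ω hω => h ?_
    rw [← Set.mem_singleton_iff.1 hω, length_pathPrefix]

lemma measurable_pathPrefix (n : ℕ) : Measurable fun ω : PathSpace m => pathPrefix ω n := by
  refine measurable_to_countable' fun u => ?_
  rw [pathPrefix_preimage_singleton]
  split_ifs
  · exact measurableSet_cyl u
  · exact MeasurableSet.empty

lemma measurable_inner_limitResidual (x y : H) :
    Measurable fun ω => inner ℂ x ((limitResidual R₀ C hC ω).op y) := by
  refine measurable_of_tendsto_metrizable (f := fun n ω => inner ℂ x (pathResidual R₀.op C n ω y))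
    (fun n => ?_) (tendsto_pi_nhds.2 fun ω =>
      tendsto_const_nhds.inner (tendsto_limitResidual R₀ C hC ω y))
  exact (Measurable.of_discrete
    (f := fun u => inner ℂ x (residual R₀.op C (livePrefix u) y))).comp (measurable_pathPrefix n)

/-- The boundary `σ`-field is trivial if and only if the boundary variable is almost surely
constant. -/
theorem isTrivialMod_boundarySigma_iff (ν : Measure (PathSpace m)) [IsProbabilityMeasure ν] :
    IsTrivialMod ν (boundarySigma R₀ C hC) ↔
      ∃ T : PosTraceClass H, ∀ᵐ ω ∂ν, limitResidual R₀ C hC ω = T := by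
  constructor
  · intro htriv
    let J : Set (basisIndex H) := {i | R₀.op (onb H i) ≠ 0}
    have : Countable J := (countable_onb_ne_zero R₀.nonneg R₀.traceClass).to_subtype
    let F : PosTraceClass H → J × J → ℂ := fun T ij =>
      inner ℂ (onb H ij.1) (T.op (onb H ij.2))
    have hF : Measurable F :=
      measurable_pi_lambda _ fun ij => (continuous_inner_apply _ _).measurable
    -- Measurability for the product σ-field comes from the strong limit, entry by entry; Borel
    -- measurability of R_∞ in the trace norm is not invoked.
    have hFR : Measurable fun ω => F (limitResidual R₀ C hC ω) :=
      measurable_pi_lambda _ fun ij => measurable_inner_limitResidual R₀ C hC _ _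
    -- Triviality decides every measurable set of countable matrices, and countably many such sets
    -- separate points.
    obtain ⟨a, ha⟩ := exists_eventuallyEq_const_of_forall_separating (l := ae ν)
      (f := fun ω => F (limitResidual R₀ C hC ω)) MeasurableSet (fun U hU => by
        rcases htriv ((fun ω => F (limitResidual R₀ C hC ω)) ⁻¹' U) ⟨F ⁻¹' U, hF hU, rfl⟩
          with h | h
        · exact Or.inr (measure_eq_zero_iff_ae_notMem.1 h)
        · exact Or.inl ((prob_compl_eq_zero_iff (hFR hU)).2 h))
    -- `a` is only an array of numbers; a sample point attaining it supplies a positive trace class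
    -- operator with these entries.
    obtain ⟨ω₀, hω₀⟩ := ha.exists
    refine ⟨limitResidual R₀ C hC ω₀, ha.mono fun ω hω => PosTraceClass.ext ?_⟩
    refine eq_of_inner_onb_eq fun i j => ?_
    by_cases hi : R₀.op (onb H i) = 0
    · simp only [inner_limitResidual_eq_zero R₀ C hC _ hi]
    by_cases hj : R₀.op (onb H j) = 0
    · simp only [limitResidual_apply_eq_zero R₀ C hC _ hj]
    exact congrFun (hω.trans hω₀.symm) (⟨i, hi⟩, ⟨j, hj⟩)
  · rintro ⟨T, hT⟩ _ ⟨B, -, rfl⟩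
    by_cases hB : T ∈ B
    · right
      rw [← measure_univ (μ := ν)]
      refine measure_congr (eventuallyEq_univ.2 (hT.mono fun ω hω => ?_))
      simpa [hω] using hB
    · left
      refine measure_eq_zero_iff_ae_notMem.2 (hT.mono fun ω hω => ?_)
      simpa [hω] using hB

lemma isTraceClass_residual {C : Fin m → H →L[ℂ] H} (hC : ∀ j, ‖C j‖ ≤ 1) (w : List (Fin m)) :
    IsTraceClass (residual R₀.op C w) := by
  induction w using List.reverseRecOn with
  | nil => exact R₀.traceClass
  | append_singleton w j ih =>
    rw [residual_append]
    exact ih.of_le (update_nonneg (hC j)) (update_le (residual_nonneg R₀.nonneg hC w))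

/-- Each diagonal entry of R_∞ is at most tr R_n for all n, hence at most 0, so R_∞ kills the basis.
-/
lemma limitResidual_eq_zero {ω : PathSpace m}
    (h : Tendsto (fun n => (opTrace (pathResidual R₀.op C n ω)).re) atTop (𝓝 0)) :
    (limitResidual R₀ C hC ω).op = 0 := by
  refine eq_of_inner_onb_eq fun i j => ?_
  rw [apply_eq_zero_of_re_inner_le_zero (limitResidual R₀ C hC ω).nonneg (x := onb H j)]
  · simp
  · refine ge_of_tendsto' h fun n => (limitResidual_re_inner_le R₀ C hC ω n _).trans ?_
    exact re_inner_onb_le_re_opTrace (residual_nonneg R₀.nonneg hC _)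
      (isTraceClass_residual R₀ hC _) j

theorem ae_limitResidual_eq_zero (ν : Measure (PathSpace m)) [IsProbabilityMeasure ν]
    (h : ∀ᵐ ω ∂ν, Tendsto (fun n => (opTrace (pathResidual R₀.op C n ω)).re) atTop (𝓝 0)) :
    (∀ᵐ ω ∂ν, (limitResidual R₀ C hC ω).op = 0) ∧ IsTrivialMod ν (boundarySigma R₀ C hC) := by
  have h0 : ∀ᵐ ω ∂ν, (limitResidual R₀ C hC ω).op = 0 :=
    h.mono fun ω => limitResidual_eq_zero R₀ C hC
  refine ⟨h0, (isTrivialMod_boundarySigma_iff R₀ C hC ν).2 ?_⟩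
  obtain ⟨ω₀, hω₀⟩ := h0.exists
  exact ⟨limitResidual R₀ C hC ω₀,
    h0.mono fun ω hω => PosTraceClass.ext (hω.trans hω₀.symm)⟩

end Boundary

end WRTree
namespace WRTree

/-! ### Geometric decay of the expected trace under leakage. -/

section Leakage

variable {H : Type*} [NormedAddCommGroup H] [InnerProductSpace ℂ H] [CompleteSpace H] {m : ℕ}

lemma setLIntegral_pathPrefix (ν : Measure (PathSpace m)) (n : ℕ)
    (g : List (Fin (m + 1)) → ENNReal) {S : Set (PathSpace m)} (hS : MeasurableSet S) :
    ∫⁻ ω in S, g (pathPrefix ω n) ∂ν =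
      ∑' u, g u * ν ((fun ω => pathPrefix ω n) ⁻¹' {u} ∩ S) := by
  rw [← lintegral_map (Measurable.of_discrete (f := g)) (measurable_pathPrefix n),
    lintegral_countable']
  refine tsum_congr fun u => ?_
  rw [Measure.map_apply (measurable_pathPrefix n) (measurableSet_singleton u),
    Measure.restrict_apply' hS]

lemma lintegral_pathPrefix (ν : Measure (PathSpace m)) (n : ℕ)
    (g : List (Fin (m + 1)) → ENNReal) :
    ∫⁻ ω, g (pathPrefix ω n) ∂ν = ∑' u, g u * ν ((fun ω => pathPrefix ω n) ⁻¹' {u}) := by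
  simpa using setLIntegral_pathPrefix ν n g MeasurableSet.univ

/-- For words of length other than n both sides vanish, so later sums may run over all words. -/
lemma IsPathMeasure.measure_inter {p : List (Fin (m + 1)) → Fin (m + 1) → ℝ}
    {ν : Measure (PathSpace m)} (hν : IsPathMeasure p ν) (n : ℕ) (u : List (Fin (m + 1)))
    (a : Fin (m + 1)) :
    ν ((fun ω => pathPrefix ω n) ⁻¹' {u} ∩ {ω | ω n = a}) =
      ν ((fun ω => pathPrefix ω n) ⁻¹' {u}) * ENNReal.ofReal (p u a) := by
  rw [pathPrefix_preimage_singleton]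
  split_ifs with h
  · rw [← hν.2, cyl_append, h]
  · simp

/-- One-step conditioning for a path measure. -/
lemma IsPathMeasure.lintegral_pathPrefix_succ {p : List (Fin (m + 1)) → Fin (m + 1) → ℝ}
    {ν : Measure (PathSpace m)} (hν : IsPathMeasure p ν) (n : ℕ)
    (g : List (Fin (m + 1)) → ENNReal) :
    ∫⁻ ω, g (pathPrefix ω (n + 1)) ∂ν =
      ∑' u, (∑ a, ENNReal.ofReal (p u a) * g (u ++ [a])) *
        ν ((fun ω => pathPrefix ω n) ⁻¹' {u}) := by
  have hS : ∀ a, MeasurableSet {ω : PathSpace m | ω n = a} := fun a =>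
    measurable_pi_apply (X := fun _ : ℕ => Fin (m + 1)) n (measurableSet_singleton a)
  -- Splitting by the next letter leaves functions of the n-prefix alone.
  have hg : ∀ ω : PathSpace m, g (pathPrefix ω (n + 1)) =
      ∑ a, {ω : PathSpace m | ω n = a}.indicator (fun ω => g (pathPrefix ω n ++ [a])) ω := by
    intro ω
    rw [pathPrefix_succ, Finset.sum_eq_single (ω n)]
    · simp
    · intro a _ ha
      exact Set.indicator_of_notMem (s := {ω : PathSpace m | ω n = a}) (fun h => ha (Eq.symm h)) _
    · simp
  have hm : ∀ a, Measurable fun ω : PathSpace m => g (pathPrefix ω n ++ [a]) := fun a =>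
    (Measurable.of_discrete (f := fun u => g (u ++ [a]))).comp (measurable_pathPrefix n)
  simp_rw [hg]
  rw [lintegral_finsetSum _ fun a _ => (hm a).indicator (hS a)]
  simp_rw [lintegral_indicator (hS _), Finset.sum_mul]
  rw [Summable.tsum_finsetSum fun _ _ => ENNReal.summable]
  refine Finset.sum_congr rfl fun a _ => ?_
  rw [setLIntegral_pathPrefix ν n (fun u => g (u ++ [a])) (hS a)]
  refine tsum_congr fun u => ?_
  rw [hν.measure_inter]
  ring

lemma livePrefix_append_zero (u : List (Fin (m + 1))) :
    livePrefix (u ++ [0]) = livePrefix u := by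
  induction u with
  | nil => rfl
  | cons b u ih => refine Fin.cases ?_ (fun i => ?_) b <;> simp [livePrefix, ih]

lemma livePrefix_append_of_mem {u : List (Fin (m + 1))} (hu : 0 ∈ u) (a : Fin (m + 1)) :
    livePrefix (u ++ [a]) = livePrefix u := by
  induction u with
  | nil => simp at hu
  | cons b u ih =>
    induction b using Fin.cases with
    | zero => rfl
    | succ i =>
      have : (0 : Fin (m + 1)) ∈ u := by simpa [(Fin.succ_ne_zero i).symm] using hu
      simp [livePrefix, ih this]

lemma livePrefix_append_succ {u : List (Fin (m + 1))} (hu : 0 ∉ u) (j : Fin m) :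
    livePrefix (u ++ [j.succ]) = livePrefix u ++ [j] := by
  induction u with
  | nil => simp [livePrefix]
  | cons b u ih =>
    rw [List.mem_cons, not_or] at hu
    induction b using Fin.cases with
    | zero => exact absurd rfl hu.1
    | succ i => simp [livePrefix, ih hu.2]

/-- A path of positive weight enters the cemetery `0` only at a node without energy. -/
lemma nodeEnergy_eq_zero_of_zero_mem {R₀ : H →L[ℂ] H} {C : Fin m → H →L[ℂ] H}
    {ν : Measure (PathSpace m)} (hν : IsPathMeasure (transition R₀ C) ν)
    {u : List (Fin (m + 1))} (hu : 0 ∈ u) (h : ν (cyl u) ≠ 0) :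
    nodeEnergy R₀ C (livePrefix u) = 0 := by
  induction u using List.reverseRecOn with
  | nil => simp at hu
  | append_singleton u a ih =>
    rw [hν.2, mul_ne_zero_iff] at h
    by_cases h0 : 0 ∈ u
    · rw [livePrefix_append_of_mem h0]
      exact ih h0 h.1
    · obtain rfl : 0 = a := by simpa [h0] using hu
      rw [livePrefix_append_zero]
      by_contra hne
      exact h.2 (by simp [transition, h0, hne])

variable (R₀ : PosTraceClass H) {C : Fin m → H →L[ℂ] H} (hC : ∀ j, ‖C j‖ ≤ 1)
include hC

/-- R_{wj} + D_{w,j} = R_w, and the trace is additive on positive trace class operators. -/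
lemma re_opTrace_residual_append (w : List (Fin m)) (j : Fin m) :
    (opTrace (residual R₀.op C (w ++ [j]))).re =
      (opTrace (residual R₀.op C w)).re - edgeEnergy R₀.op C w j := by
  have hR := residual_nonneg R₀.nonneg hC w
  have hU : residual R₀.op C (w ++ [j]) + dissipation R₀.op C w j = residual R₀.op C w := by
    rw [residual_append, update, dissipation, ← add_mul, ← mul_add, sub_add_cancel, mul_one,
      CFC.sqrt_mul_sqrt_self _ hR]
  have h0 := residual_nonneg R₀.nonneg hC (w ++ [j])
  have hD := dissipation_nonneg R₀.op C w j
  have hDR : dissipation R₀.op C w j ≤ residual R₀.op C w := by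
    rw [← hU]
    exact le_add_of_nonneg_left h0
  have := re_opTrace_add h0 hD (isTraceClass_residual R₀ hC _)
    ((isTraceClass_residual R₀ hC w).of_le hD hDR)
  rw [hU] at this
  rw [this, edgeEnergy, add_sub_cancel_right]

/-- Under trace leakage with constant `α`, one step of the trace-biased walk contracts the
expected trace by the factor `1 - α / m`. -/
lemma sum_transition_mul_re_opTrace_le (hm : 1 ≤ m) {α : ℝ} (hα : 0 < α)
    (hleak : ∀ w, α * (opTrace (residual R₀.op C w)).re ≤ nodeEnergy R₀.op C w)
    {u : List (Fin (m + 1))} (hu : 0 ∈ u → nodeEnergy R₀.op C (livePrefix u) = 0) :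
    ∑ a, transition R₀.op C u a * (opTrace (residual R₀.op C (livePrefix (u ++ [a])))).re ≤
      (1 - α / m) * (opTrace (residual R₀.op C (livePrefix u))).re := by
  set w := livePrefix u with hw
  have ht : 0 ≤ (opTrace (residual R₀.op C w)).re :=
    re_opTrace_nonneg (residual_nonneg R₀.nonneg hC w)
  by_cases hs : nodeEnergy R₀.op C w = 0
  -- With no energy, leakage reads α t ≤ 0, so t = 0; the walk moves to 0 and the residual stays
  -- frozen.
  · have ht0 : (opTrace (residual R₀.op C w)).re = 0 := by
      have := hleak w
      rw [hs] at this
      nlinarith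
    rw [ht0, mul_zero, Finset.sum_eq_single 0]
    · rw [livePrefix_append_zero, ← hw, ht0, mul_zero]
    · intro a _ ha
      simp [transition, ← hw, hs, ha]
    · simp
  have h0 : 0 ∉ u := fun h => hs (hu h)
  set t := (opTrace (residual R₀.op C w)).re
  set s := nodeEnergy R₀.op C w with hsdef
  have hspos : 0 < s :=
    lt_of_le_of_ne (Finset.sum_nonneg fun i _ => edgeEnergy_nonneg _ _ _ _) (Ne.symm hs)
  have hmpos : (0 : ℝ) < m := by exact_mod_cast hm
  have hcs : s ^ 2 ≤ m * ∑ j, edgeEnergy R₀.op C w j ^ 2 := by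
    have := sq_sum_le_card_mul_sum_sq (s := Finset.univ) (f := fun j => edgeEnergy R₀.op C w j)
    rwa [Finset.card_univ, Fintype.card_fin] at this
  -- The weights e_j / s sum to one, so averaging t - e_j gives t - ∑ e_j² / s.
  have hsum : ∑ a, transition R₀.op C u a *
      (opTrace (residual R₀.op C (livePrefix (u ++ [a])))).re =
        t - (∑ j, edgeEnergy R₀.op C w j ^ 2) / s := by
    have hj : ∀ j : Fin m, transition R₀.op C u j.succ *
        (opTrace (residual R₀.op C (livePrefix (u ++ [j.succ])))).re =
          t / s * edgeEnergy R₀.op C w j - edgeEnergy R₀.op C w j ^ 2 / s := by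
      intro j
      rw [livePrefix_append_succ h0, ← hw, re_opTrace_residual_append R₀ hC]
      simp only [transition, ← hw, ← hsdef, h0, hs, or_self, if_false, Fin.cases_succ]
      ring
    have hz : transition R₀.op C u 0 = 0 := by
      simp [transition, ← hw, ← hsdef, h0, hs]
    rw [Fin.sum_univ_succ, hz, zero_mul, zero_add, Finset.sum_congr rfl fun j _ => hj j,
      Finset.sum_sub_distrib, ← Finset.mul_sum, ← Finset.sum_div]
    congr 1
    exact div_mul_cancel₀ t hs
  have h1 : s / m ≤ (∑ j, edgeEnergy R₀.op C w j ^ 2) / s := by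
    rw [div_le_div_iff₀ hmpos hspos]
    nlinarith
  have h2 : α * t / m ≤ s / m := by
    gcongr
    exact hleak w
  rw [hsum]
  have h3 : (1 - α / m) * t = t - α * t / m := by ring
  linarith

theorem ae_tendsto_re_opTrace_of_leakage (hm : 1 ≤ m) {ν : Measure (PathSpace m)}
    (hν : IsPathMeasure (transition R₀.op C) ν) (hleak : UniformTraceLeakage R₀.op C) :
    ∀ᵐ ω ∂ν, Tendsto (fun n => (opTrace (pathResidual R₀.op C n ω)).re) atTop (𝓝 0) := by
  obtain ⟨α, hα, hαm, hleak⟩ := hleak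
  have hmpos : (0 : ℝ) < m := by exact_mod_cast hm
  let τ : List (Fin (m + 1)) → ℝ := fun u => (opTrace (residual R₀.op C (livePrefix u))).re
  have hτ : ∀ u, 0 ≤ τ u := fun u => re_opTrace_nonneg (residual_nonneg R₀.nonneg hC _)
  let g : List (Fin (m + 1)) → ENNReal := fun u => ENNReal.ofReal (τ u)
  have hgm : ∀ n, Measurable fun ω : PathSpace m => g (pathPrefix ω n) := fun n =>
    (Measurable.of_discrete (f := g)).comp (measurable_pathPrefix n)
  set q := ENNReal.ofReal (1 - α / m)
  -- α ≤ m enters here; it makes `ENNReal.ofReal` multiplicative on (1 - α/m) τ.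
  have hq0 : 0 ≤ 1 - α / m := sub_nonneg.2 ((div_le_one hmpos).2 hαm)
  have hq1 : q < 1 := by
    rw [← ENNReal.ofReal_one]
    exact (ENNReal.ofReal_lt_ofReal_iff one_pos).2 (sub_lt_self 1 (div_pos hα hmpos))
  have hstep : ∀ n, ∫⁻ ω, g (pathPrefix ω (n + 1)) ∂ν ≤ q * ∫⁻ ω, g (pathPrefix ω n) ∂ν := by
    intro n
    rw [hν.lintegral_pathPrefix_succ, lintegral_pathPrefix, ← ENNReal.tsum_mul_left]
    refine ENNReal.tsum_le_tsum fun u => ?_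
    rw [← mul_assoc]
    -- A null word may contain 0 after a live prefix with energy, where the contraction can fail;
    -- such words contribute nothing.
    by_cases h : ν ((fun ω => pathPrefix ω n) ⁻¹' {u}) = 0
    · simp [h]
    have hu : 0 ∈ u → nodeEnergy R₀.op C (livePrefix u) = 0 := by
      intro h0
      refine nodeEnergy_eq_zero_of_zero_mem hν h0 fun hz => h ?_
      rw [pathPrefix_preimage_singleton]
      split_ifs <;> simp [hz]
    gcongr
    calc ∑ a, ENNReal.ofReal (transition R₀.op C u a) * g (u ++ [a])
        = ENNReal.ofReal (∑ a, transition R₀.op C u a * τ (u ++ [a])) := by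
          rw [ENNReal.ofReal_sum_of_nonneg fun a _ =>
            mul_nonneg (transition_nonneg _ _ _ _) (hτ _)]
          exact Finset.sum_congr rfl fun a _ =>
            (ENNReal.ofReal_mul (transition_nonneg _ _ _ _)).symm
      _ ≤ ENNReal.ofReal ((1 - α / m) * τ u) := ENNReal.ofReal_le_ofReal
          (sum_transition_mul_re_opTrace_le R₀ hC hm hα hleak hu)
      _ = q * g u := ENNReal.ofReal_mul hq0
  have hgeom : ∀ n, ∫⁻ ω, g (pathPrefix ω n) ∂ν ≤ q ^ n * g [] := by
    intro n
    induction n with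
    | zero =>
      have : ∀ ω : PathSpace m, pathPrefix ω 0 = [] := fun ω => rfl
      simp [this, ← cyl_nil, hν.1]
    | succ n ih =>
      refine (hstep n).trans ?_
      rw [pow_succ', mul_assoc]
      gcongr
  -- Tonelli and the geometric series: the sum of all traces along a path has finite mean.
  have hfin : ∫⁻ ω, ∑' n, g (pathPrefix ω n) ∂ν ≠ ⊤ := by
    rw [lintegral_tsum fun n => (hgm n).aemeasurable]
    refine ne_top_of_le_ne_top ?_ (ENNReal.tsum_le_tsum hgeom)
    rw [ENNReal.tsum_mul_right, ENNReal.tsum_geometric]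
    exact ENNReal.mul_ne_top (ENNReal.inv_ne_top.2 (tsub_pos_of_lt hq1).ne')
      ENNReal.ofReal_ne_top
  refine (ae_lt_top (Measurable.tsum hgm) hfin).mono fun ω hω => ?_
  have h := (ENNReal.tendsto_toReal ENNReal.zero_ne_top).comp
    (ENNReal.tendsto_atTop_zero_of_tsum_ne_top hω.ne)
  exact h.congr fun n => ENNReal.toReal_ofReal (hτ _)

end Leakage

end WRTree

theorem mainTheorem9 {H : Type*} [NormedAddCommGroup H] [InnerProductSpace ℂ H] [CompleteSpace H]
    {m : ℕ} (hm : 1 ≤ m) (R₀ : PosTraceClass H) (C : Fin m → H →L[ℂ] H) (hC : ∀ j, ‖C j‖ ≤ 1) :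
    (IsTrivialMod (traceMeasure R₀.op C) (boundarySigma R₀ C hC) ↔
      ∃ T : PosTraceClass H, ∀ᵐ ω ∂(traceMeasure R₀.op C), limitResidual R₀ C hC ω = T) ∧
    ((∀ᵐ ω ∂(traceMeasure R₀.op C),
        Tendsto (fun n => (opTrace (pathResidual R₀.op C n ω)).re) atTop (𝓝 0)) →
      (∀ᵐ ω ∂(traceMeasure R₀.op C), (limitResidual R₀ C hC ω).op = 0) ∧
        IsTrivialMod (traceMeasure R₀.op C) (boundarySigma R₀ C hC)) ∧
    (UniformTraceLeakage R₀.op C →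
      (∀ᵐ ω ∂(traceMeasure R₀.op C),
        Tendsto (fun n => (opTrace (pathResidual R₀.op C n ω)).re) atTop (𝓝 0)) ∧
      (∀ᵐ ω ∂(traceMeasure R₀.op C), (limitResidual R₀ C hC ω).op = 0) ∧
        IsTrivialMod (traceMeasure R₀.op C) (boundarySigma R₀ C hC))
 := by
  have hν := isPathMeasure_traceMeasure R₀.op C
  refine ⟨isTrivialMod_boundarySigma_iff R₀ C hC _, ae_limitResidual_eq_zero R₀ C hC _,
    fun hleak => ?_⟩
  have h := ae_tendsto_re_opTrace_of_leakage R₀ hC hm hν hleak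
  exact ⟨h, ae_limitResidual_eq_zero R₀ C hC _ h⟩
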